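/- Equip $\mathbb{R}^4$ with the form $(\mathbf s,\mathbf t)=\tfrac14\sum_i s_it_i-\tfrac18\left(\sum_i s_i\right)\left(\sum_i t_i\right)$; this is the bilinear form of the root system with Cartan matrix having $2$ on and $-2$ off the diagonal, in coordinates $\mathbf s=\sum_i s_i\omega_i$ with respect to the fundamental weights. In $\mathbb{RP}^3$ let $J=\{\mathbf s : (\mathbf s,\mathbf s)<0\}$ and $N=\{\mathbf s : (\mathbf s,\mathbf s)=0\}$. Circles on $N$ are the sections of $N$ by planes that contain more than one point, and two circles are tangent if they have exactly one common point. Segments and rays are taken in the affine section $s_1+s_2+s_3+s_4=1$ of $\mathbb{RP}^3$, in which $N$ is a sphere enclosing $J$. The four planes $s_1+s_2+s_3+s_4-2s_i=0$ $(1\le i\le 4)$ intersect $N$ in four mutually tangent circles. Let $\mathcal T$ be the Apollonian packing on $N$ generated by them, i.e. the set of all circles occurring in quadruples obtained from this base quadruple by finitely many steps, each of which keeps three circles of a quadruple and replaces the remaining one by the other circle tangent to these three. For each $S\in\mathcal T$ let $O_S$ be an open spherical cap of $N$ with boundary $S$, chosen so that the sets $O_S$ $(S\in\mathcal T)$ are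 pairwise disjoint, and let $\mathbf p_S$ be the unique point of $\mathbb{RP}^3$ such that the cone on $S$ with apex $\mathbf p_S$ is tangent to $N$ (each line through $\mathbf p_S$ and a point $q\in S$ meets $N$ only at $q$). Let $C_S$ be the bounded cone on $O_S$ with apex $\mathbf p_S$, and $C_S'$ the unbounded cone, both without their apex: $$C_S=\{(1-t)\mathbf p_S+t\mathbf r : \mathbf r\in O_S,\ 0<t\le 1\},\qquad C_S'=\{(1-t)\mathbf p_S+t\mathbf r : \mathbf r\in O_S,\ t>0\}.$$ Let $F\subset N$ be the set of points of $N$ that lie on no circle $S\in\mathcal T$ and in no cap $O_S$. **Proposition.** The points $\mathbf p_S$ $(S\in\mathcal T)$ exist and are unique, a choice of pairwise disjoint caps $O_S$ exists, and for any such choice $$\bigcap_{S\in\mathcal T} C_S' \;=\; J\cup F\cup\bigcup_{S\in\mathcal T} C_S .$$ -/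

import Mathlib

open scoped LinearAlgebra.Projectivization

noncomputable section

namespace ApollonianCone

/-- Real four-space; `s : V` is the vector `s₁ω₁ + s₂ω₂ + s₃ω₃ + s₄ω₄` in the basis of fundamental
weights. -/
abbrev V : Type := Fin 4 → ℝ

/-- The projective space `ℝP³`. -/
abbrev P3 : Type := ℙ ℝ V

/-- The Cartan matrix of the Apollonian root system: the Gram matrix of the simple roots. -/
def cartan : Matrix (Fin 4) (Fin 4) ℝ := Matrix.of fun i j => if i = j then 2 else -2

/-- The bilinear form of the root system in weight coordinates. The fundamental weights are the
basis dual to the simple roots, so their Gram matrix is the inverse of the Cartan matrix. -/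
def form (s t : V) : ℝ := s ⬝ᵥ (cartan⁻¹).mulVec t

/-- The sum of the four coordinates, `s₁ + s₂ + s₃ + s₄`. -/
def total : Module.Dual ℝ V := ∑ i, LinearMap.proj i

theorem total_apply (s : V) : total s = ∑ i, s i := by
  simp [total]

theorem cartan_inv :
    cartan⁻¹ = Matrix.of fun i j : Fin 4 => if i = j then (1 / 8 : ℝ) else -1 / 8 := by
  apply Matrix.inv_eq_right_inv
  ext i j
  fin_cases i <;> fin_cases j <;>
    simp [cartan, Matrix.mul_apply, Fin.sum_univ_four] <;> norm_num

theorem form_eq (s t : V) : form s t = (∑ i, s i * t i) / 4 - (∑ i, s i) * (∑ i, t i) / 8 := by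
  simp [form, cartan_inv, Matrix.mulVec, dotProduct, Fin.sum_univ_four]
  ring

/-- The timelike region `J` in `ℝP³`. -/
def timelike : Set P3 := {x | ∃ v ∈ x.submodule, form v v < 0}

/-- The lightlike quadric `N` in `ℝP³`. -/
def lightlike : Set P3 := {x | ∀ v ∈ x.submodule, form v v = 0}

/-- The projective plane `f = 0` (for `f ≠ 0`). -/
def plane (f : Module.Dual ℝ V) : Set P3 := {x | ∀ v ∈ x.submodule, f v = 0}

/-- A circle on `N`: a section of `N` by a plane, with more than one point. -/
def IsCircle (S : Set P3) : Prop :=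
  S.Nontrivial ∧ ∃ f : Module.Dual ℝ V, f ≠ 0 ∧ S = lightlike ∩ plane f

/-- Two circles on `N` are tangent when they have exactly one common point. -/
def Tangent (S T : Set P3) : Prop := ∃ x, S ∩ T = {x}

/-- The section of `N` by the plane `s₁ + s₂ + s₃ + s₄ - 2 sᵢ = 0`. -/
def baseCircle (i : Fin 4) : Set P3 :=
  lightlike ∩ plane (total - (2 : ℝ) • LinearMap.proj i)

/-- The Descartes quadruples of the Apollonian packing: the base quadruple, and every quadruple
obtained from one already present by keeping three circles and exchanging the remaining one for
the other circle tangent to these three. -/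
inductive IsQuadruple : (Fin 4 → Set P3) → Prop
  | base : IsQuadruple baseCircle
  | swap (Q : Fin 4 → Set P3) (i : Fin 4) (S : Set P3) (hQ : IsQuadruple Q) (hS : IsCircle S)
      (hne : S ≠ Q i) (ht : ∀ j, j ≠ i → Tangent S (Q j)) : IsQuadruple (Function.update Q i S)

/-- The Apollonian packing `𝒯`, as the set of its circles. -/
def packing : Set (Set P3) := {S | ∃ Q, IsQuadruple Q ∧ ∃ i, Q i = S}

/-- `O` is one of the two open caps of `N` with boundary circle `S`. Representatives are taken in
the affine section `s₁ + s₂ + s₃ + s₄ = 1`, in which `N` is a round sphere. -/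
def IsOpenCap (O S : Set P3) : Prop :=
  ∃ f : Module.Dual ℝ V, f ≠ 0 ∧ S = lightlike ∩ plane f ∧
    O = {x ∈ lightlike | ∃ v ∈ x.submodule, total v = 1 ∧ 0 < f v}

/-- A choice of open caps bounded by the circles of the packing, with all caps disjoint. -/
structure IsCapSystem (O : packing → Set P3) : Prop where
  isOpenCap : ∀ S, IsOpenCap (O S) S
  disjoint : ∀ S T, S ≠ T → Disjoint (O S) (O T)

/-- The cone on `S` with apex `p` is tangent to `N`: each line joining `p` to a point `q` of `S`
meets `N` in `q` only. -/
def IsTangentApex (p : P3) (S : Set P3) : Prop :=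
  ∀ q ∈ S, p ≠ q ∧ ∀ x ∈ lightlike, x.submodule ≤ p.submodule ⊔ q.submodule → x = q

/-- The unbounded cone with apex `p` on `R`, apex excluded: all open rays from `p` through a point
of `R`, formed in the affine section `s₁ + s₂ + s₃ + s₄ = 1`. -/
def unboundedCone (p : P3) (R : Set P3) : Set P3 :=
  {x | ∃ a ∈ p.submodule, ∃ r ∈ R, ∃ b ∈ r.submodule, total a = 1 ∧ total b = 1 ∧
    ∃ t : ℝ, 0 < t ∧ (1 - t) • a + t • b ∈ x.submodule}

/-- The bounded cone with apex `p` on `R`, apex excluded: all segments from `p` (excluded) to a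
point of `R` (included), formed in the affine section `s₁ + s₂ + s₃ + s₄ = 1`. -/
def boundedCone (p : P3) (R : Set P3) : Set P3 :=
  {x | ∃ a ∈ p.submodule, ∃ r ∈ R, ∃ b ∈ r.submodule, total a = 1 ∧ total b = 1 ∧
    ∃ t : ℝ, 0 < t ∧ t ≤ 1 ∧ (1 - t) • a + t • b ∈ x.submodule}

/-- The residual set `F`: the points of `N` on no circle of the packing and in none of the caps. -/
def residualSet (O : packing → Set P3) : Set P3 :=
  {x ∈ lightlike | ∀ S : packing, x ∉ (S : Set P3) ∧ x ∉ O S}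

end ApollonianCone

end

open scoped LinearAlgebra.Projectivization

namespace ApollonianCone

/-! The form is Lorentzian: it is positive definite on the hyperplane `total = 0`. A circle on `N`
is therefore the polar section of a spacelike vector, and the apex of the tangent cone is the
projective point of that vector (`IsFrame.isTangentApex_iff`). The base circles are polar to the
fundamental weights, which have norm 1/8 and mutual products -1/8. Exchanging a circle of a
Descartes quadruple is reflection in a simple root (`IsFrame.eq_circ_swapVec`), so the poles of the
packing are the orbit of the fundamental weights under the reflection group.

Two facts about this orbit carry the theorem. Separation: distinct weights have product at most -1/8
(`Reach.eq_or_form_le`), so their positive caps are disjoint, and these are the only possible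
pairwise disjoint caps (`IsCapSystem.eq_cap`). Density: every spacelike vector has positive product
with some weight (`exists_form_pos`).

A point of the intersection that is neither timelike nor lightlike is spacelike. By density it lies
on the cap side of the polar plane of some apex, and there the unbounded cone contains no spacelike
points outside the bounded one. Lightlike points of the intersection lie on no circle, hence in a
cap or in `F`. Conversely, membership in an unbounded cone reduces to the line through the apex
crossing `N` in two points (`mem_unboundedCone_of_discrim`). This is immediate for `J` and `F`; for
a bounded cone over another circle it follows from separation. -/

theorem form_comm (s t : V) : form s t = form t s := by
  simp only [form_eq, Fin.sum_univ_four]; ring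

theorem form_add_left (s s' t : V) : form (s + s') t = form s t + form s' t := by
  simp only [form_eq, Fin.sum_univ_four, Pi.add_apply]; ring

theorem form_add_right (s t t' : V) : form s (t + t') = form s t + form s t' := by
  simp only [form_eq, Fin.sum_univ_four, Pi.add_apply]; ring

theorem form_sub_left (s s' t : V) : form (s - s') t = form s t - form s' t := by
  simp only [form_eq, Fin.sum_univ_four, Pi.sub_apply]; ring

theorem form_sub_right (s t t' : V) : form s (t - t') = form s t - form s t' := by
  simp only [form_eq, Fin.sum_univ_four, Pi.sub_apply]; ring

theorem form_smul_left (c : ℝ) (s t : V) : form (c • s) t = c * form s t := by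
  simp only [form_eq, Fin.sum_univ_four, Pi.smul_apply, smul_eq_mul]; ring

theorem form_smul_right (c : ℝ) (s t : V) : form s (c • t) = c * form s t := by
  simp only [form_eq, Fin.sum_univ_four, Pi.smul_apply, smul_eq_mul]; ring

theorem form_zero_left (t : V) : form 0 t = 0 := by
  simp [form_eq]

theorem form_sum_right (s : V) (w : Fin 4 → V) : form s (∑ i, w i) = ∑ i, form s (w i) := by
  simp only [Fin.sum_univ_four, form_add_right]

/-! ### Lorentzian geometry of the form -/

/-- On this hyperplane the form is a quarter of the Euclidean one. The causal inequalities below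
come from applying this to a combination whose total vanishes. -/
theorem form_nonneg_of_total_eq_zero {v : V} (h : total v = 0) : 0 ≤ form v v := by
  rw [total_apply] at h
  rw [form_eq, h]
  have : 0 ≤ ∑ i, v i * v i := Finset.sum_nonneg fun i _ => mul_self_nonneg _
  linarith

theorem eq_zero_of_total_eq_zero {v : V} (h : total v = 0) (h0 : form v v ≤ 0) : v = 0 := by
  rw [total_apply] at h
  rw [form_eq, h] at h0
  rw [Fin.sum_univ_four] at h0
  funext i
  fin_cases i <;> simp <;>
    nlinarith [mul_self_nonneg (v 0), mul_self_nonneg (v 1), mul_self_nonneg (v 2),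
      mul_self_nonneg (v 3)]

theorem eq_zero_of_form_eq_zero {v : V} (h : ∀ u, form v u = 0) : v = 0 := by
  have h4 : total v = 0 := by
    have := h 1
    rw [form_eq] at this
    simp only [Pi.one_apply, mul_one, Finset.sum_const, Finset.card_univ, Fintype.card_fin] at this
    rw [total_apply]
    norm_num at this
    linarith
  exact eq_zero_of_total_eq_zero h4 (h v).le

theorem exists_form_eq (f : Module.Dual ℝ V) : ∃ u, ∀ v, form u v = f v := by
  -- The coefficients are the Cartan matrix, `4 I - 2 J` with `J` the all-ones matrix, applied to
  -- the values of `f` on the standard basis.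
  refine ⟨fun i => 4 * f (Pi.single i 1) - 2 * ∑ j, f (Pi.single j 1), fun v => ?_⟩
  have hv : f v = ∑ i, v i * f (Pi.single i 1) := by
    conv_lhs => rw [pi_eq_sum_univ' v]
    simp
  rw [hv, form_eq]
  simp only [Fin.sum_univ_four]
  ring

/-- The reverse Cauchy-Schwarz inequality for a lightlike vector and a causal vector. -/
theorem form_nonpos_of_causal {x y : V} (hx : form x x = 0) (hxt : 0 < total x)
    (hy : form y y ≤ 0) (hyt : 0 < total y) : form x y ≤ 0 := by
  have hz := form_nonneg_of_total_eq_zero (v := total y • x - total x • y) (by simp; ring)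
  simp only [form_sub_left, form_sub_right, form_smul_left, form_smul_right, hx, form_comm y x]
    at hz
  have h1 : 0 < total x * total y := mul_pos hxt hyt
  by_contra! h
  nlinarith [mul_pos h1 h, mul_nonneg (sq_nonneg (total x)) (neg_nonneg.2 hy)]

theorem total_ne_zero_of_lightlike {v : V} (hv : v ≠ 0) (h : form v v = 0) : total v ≠ 0 :=
  fun h0 => hv (eq_zero_of_total_eq_zero h0 h.le)

/-- Orthogonal lightlike vectors are proportional. -/
theorem eq_smul_of_lightlike {n m : V} (hn0 : n ≠ 0) (hn : form n n = 0) (hm : form m m = 0)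
    (hnm : form n m = 0) : m = (total m / total n) • n := by
  have ht := total_ne_zero_of_lightlike hn0 hn
  have hz := eq_zero_of_total_eq_zero (v := total n • m - total m • n) (by simp; ring)
    (by simp only [form_sub_left, form_sub_right, form_smul_left, form_smul_right, hn, hm,
          form_comm m n, hnm]; simp)
  have h2 : total n • m = total m • n := sub_eq_zero.1 hz
  rw [div_eq_inv_mul, mul_smul, ← h2, smul_smul, inv_mul_cancel₀ ht, one_smul]

/-- A nonzero vector orthogonal to two distinct lightlike directions is spacelike. -/
theorem form_pos_of_orthogonal {u n m : V} (hu : u ≠ 0) (hn : form n n = 0) (hm : form m m = 0)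
    (hnt : total n = 1) (hmt : total m = 1) (hnm : n ≠ m) (hun : form u n = 0)
    (hum : form u m = 0) : 0 < form u u := by
  have h1 : form n m < 0 := by
    by_contra! h
    refine hnm (sub_eq_zero.1 (eq_zero_of_total_eq_zero (by simp [hnt, hmt]) ?_))
    simp only [form_sub_left, form_sub_right, form_comm m n, hn, hm]
    linarith
  by_cases hut : total u = 0
  · by_contra! h
    exact hu (eq_zero_of_total_eq_zero hut h)
  -- The coefficients make the total zero; the norm is `4 (u,u) + 2 (total u)² (n,m)` with `(n,m) <
  -- 0`.
  have hz := form_nonneg_of_total_eq_zero (v := (2 : ℝ) • u - total u • (n + m))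
    (by simp [hnt, hmt]; ring)
  simp only [form_sub_left, form_sub_right, form_smul_left, form_smul_right, form_add_left,
    form_add_right, form_comm n u, form_comm m u, form_comm m n, hn, hm, hun, hum] at hz
  have := pow_pos (abs_pos.2 hut) 2
  rw [sq_abs] at this
  nlinarith [mul_pos this (neg_pos.2 h1)]

/-! ### Points of projective space -/

theorem submodule_eq_span {x : P3} {v : V} (hv : v ∈ x.submodule) (h0 : v ≠ 0) :
    x.submodule = Submodule.span ℝ {v} := by
  rw [x.submodule_eq] at hv ⊢
  obtain ⟨c, rfl⟩ := Submodule.mem_span_singleton.1 hv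
  have hc : c ≠ 0 := by rintro rfl; simp at h0
  exact (Submodule.span_singleton_smul_eq (IsUnit.mk0 c hc) _).symm

theorem eq_of_mem_submodule {x y : P3} {v : V} (hx : v ∈ x.submodule) (hy : v ∈ y.submodule)
    (h0 : v ≠ 0) : x = y :=
  Projectivization.submodule_injective
    ((submodule_eq_span hx h0).trans (submodule_eq_span hy h0).symm)

theorem exists_smul_of_mem {x : P3} {v y : V} (hv : v ∈ x.submodule) (h0 : v ≠ 0)
    (hy : y ∈ x.submodule) : ∃ c : ℝ, y = c • v := by
  rw [submodule_eq_span hv h0] at hy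
  obtain ⟨c, rfl⟩ := Submodule.mem_span_singleton.1 hy
  exact ⟨c, rfl⟩

theorem mem_mk (v : V) (hv : v ≠ 0) : v ∈ (Projectivization.mk ℝ v hv).submodule := by
  rw [Projectivization.submodule_mk]
  exact Submodule.mem_span_singleton_self v

theorem rep_mem (x : P3) : x.rep ∈ x.submodule := by
  rw [x.submodule_eq]; exact Submodule.mem_span_singleton_self _

theorem ne_zero_of_total {v : V} (h : total v = 1) : v ≠ 0 := by
  rintro rfl; simp at h

theorem eq_of_total {x : P3} {v y : V} (hv : v ∈ x.submodule) (hy : y ∈ x.submodule)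
    (hvt : total v = 1) (hyt : total y = 1) : y = v := by
  obtain ⟨c, rfl⟩ := exists_smul_of_mem hv (ne_zero_of_total hvt) hy
  have : c = 1 := by simpa [hvt] using hyt
  simp [this]

theorem mem_lightlike_of_mem {x : P3} {v : V} (hv : v ∈ x.submodule) (h0 : v ≠ 0)
    (h : form v v = 0) : x ∈ lightlike := by
  intro y hy
  obtain ⟨c, rfl⟩ := exists_smul_of_mem hv h0 hy
  simp [form_smul_left, form_smul_right, h]

theorem exists_total_eq_one {x : P3} {v : V} (hv : v ∈ x.submodule) (h : total v ≠ 0) :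
    ∃ y ∈ x.submodule, total y = 1 ∧ y = (total v)⁻¹ • v :=
  ⟨(total v)⁻¹ • v, x.submodule.smul_mem _ hv, by simp [h], rfl⟩

theorem exists_rep_of_lightlike {x : P3} (hx : x ∈ lightlike) :
    ∃ v ∈ x.submodule, total v = 1 ∧ form v v = 0 := by
  obtain ⟨y, hy, hyt, -⟩ := exists_total_eq_one (rep_mem x)
    (total_ne_zero_of_lightlike x.rep_nonzero (hx _ (rep_mem x)))
  exact ⟨y, hy, hyt, hx _ hy⟩

theorem exists_rep_of_timelike {x : P3} (hx : x ∈ timelike) :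
    ∃ v ∈ x.submodule, total v = 1 ∧ form v v < 0 := by
  obtain ⟨v, hv, h⟩ := hx
  have ht : total v ≠ 0 := fun h0 => (form_nonneg_of_total_eq_zero h0).not_gt h
  obtain ⟨y, hy, hyt, rfl⟩ := exists_total_eq_one hv ht
  refine ⟨_, hy, hyt, ?_⟩
  rw [form_smul_left, form_smul_right, ← mul_assoc]
  exact mul_neg_of_pos_of_neg (mul_self_pos.2 (inv_ne_zero ht)) h

/-! ### Circles and caps with a given pole -/

/-- The circle on `N` in the plane orthogonal to `u`. -/
def circ (u : V) : Set P3 := {x ∈ lightlike | ∀ v ∈ x.submodule, form u v = 0}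

/-- The open cap of `N` on the positive side of the plane orthogonal to `u`. -/
def cap (u : V) : Set P3 := {x ∈ lightlike | ∃ v ∈ x.submodule, total v = 1 ∧ 0 < form u v}

theorem mem_circ_of_mem {u v : V} {x : P3} (hv : v ∈ x.submodule) (h0 : v ≠ 0)
    (h : form v v = 0) (huv : form u v = 0) : x ∈ circ u := by
  refine ⟨mem_lightlike_of_mem hv h0 h, fun y hy => ?_⟩
  obtain ⟨c, rfl⟩ := exists_smul_of_mem hv h0 hy
  simp [form_smul_right, huv]

theorem circ_eq_of_form_eq {u : V} {f : Module.Dual ℝ V} {c : ℝ} (hc : c ≠ 0)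
    (h : ∀ v, f v = c * form u v) : circ u = lightlike ∩ plane f := by
  ext x
  simp [circ, plane, h, hc]

theorem circ_smul {c : ℝ} (hc : c ≠ 0) (u : V) : circ (c • u) = circ u := by
  ext x
  simp [circ, form_smul_left, hc]

theorem cap_smul {c : ℝ} (hc : 0 < c) (u : V) : cap (c • u) = cap u := by
  ext x
  simp [cap, form_smul_left, hc]

/-- The linear functional `form u`. -/
noncomputable def formLeft (u : V) : Module.Dual ℝ V where
  toFun v := form u v
  map_add' := form_add_right u
  map_smul' c v := by simp [form_smul_right]

theorem formLeft_apply (u v : V) : formLeft u v = form u v := rfl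

theorem circ_eq_plane (u : V) : circ u = lightlike ∩ plane (formLeft u) := rfl

theorem formLeft_ne_zero {u : V} (hu : u ≠ 0) : formLeft u ≠ 0 := by
  intro h
  exact hu (eq_zero_of_form_eq_zero fun v => by rw [← formLeft_apply, h]; rfl)

theorem isOpenCap_cap {u : V} (hu : u ≠ 0) : IsOpenCap (cap u) (circ u) :=
  ⟨formLeft u, formLeft_ne_zero hu, circ_eq_plane u, rfl⟩

theorem isCircle_iff {S : Set P3} :
    IsCircle S ↔ S.Nontrivial ∧ ∃ u, u ≠ 0 ∧ S = circ u := by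
  constructor
  · rintro ⟨h, f, hf, rfl⟩
    obtain ⟨u, hu⟩ := exists_form_eq f
    refine ⟨h, u, ?_, (circ_eq_of_form_eq one_ne_zero fun v => by simp [hu]).symm⟩
    rintro rfl
    exact hf (LinearMap.ext fun v => by simp [← hu, form_zero_left])
  · rintro ⟨h, u, hu, rfl⟩
    exact ⟨h, formLeft u, formLeft_ne_zero hu, rfl⟩

theorem isOpenCap_iff {O S : Set P3} :
    IsOpenCap O S ↔ ∃ u, u ≠ 0 ∧ S = circ u ∧ O = cap u := by
  constructor
  · rintro ⟨f, hf, rfl, rfl⟩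
    obtain ⟨u, hu⟩ := exists_form_eq f
    refine ⟨u, ?_, (circ_eq_of_form_eq one_ne_zero fun v => by simp [hu]).symm, by
      simp [cap, hu]⟩
    rintro rfl
    exact hf (LinearMap.ext fun v => by simp [← hu, form_zero_left])
  · rintro ⟨u, hu, rfl, rfl⟩
    exact isOpenCap_cap hu

theorem form_pos_of_nontrivial {u : V} (hu : u ≠ 0) (h : (circ u).Nontrivial) :
    0 < form u u := by
  obtain ⟨x, hx, y, hy, hxy⟩ := h
  obtain ⟨n, hn, hnt, hn0⟩ := exists_rep_of_lightlike hx.1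
  obtain ⟨m, hm, hmt, hm0⟩ := exists_rep_of_lightlike hy.1
  refine form_pos_of_orthogonal hu hn0 hm0 hnt hmt ?_ (hx.2 n hn) (hy.2 m hm)
  rintro rfl
  exact hxy (eq_of_mem_submodule hn hm (ne_zero_of_total hnt))

/-- The poles of tangent circles have degenerate Gram matrix. -/
theorem gram_eq_zero_of_tangent {u w : V} (h : Tangent (circ u) (circ w)) :
    form u u * form w w = form u w ^ 2 := by
  obtain ⟨x, hx⟩ := h
  have hxm : x ∈ circ u ∩ circ w := hx ▸ rfl
  obtain ⟨n, hn, hnt, hn0⟩ := exists_rep_of_lightlike hxm.1.1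
  have hnz := ne_zero_of_total hnt
  have hun := hxm.1.2 n hn
  have hwn := hxm.2.2 n hn
  -- If `m` were not orthogonal to `n`, the line through `m` and `n` would meet `N` in a second
  -- point, also common to both circles.
  have key : ∀ m, form u m = 0 → form w m = 0 → form n m = 0 := by
    intro m hum hwm
    by_contra hnm
    set m' := m - (form m m / (2 * form n m)) • n with hm'
    have hm'0 : form m' m' = 0 := by
      simp only [hm', form_sub_left, form_sub_right, form_smul_left, form_smul_right, hn0,
        form_comm m n]
      field_simp
      ring
    have hnm' : form n m' = form n m := by
      simp only [hm', form_sub_right, form_smul_right, hn0]; ring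
    have hm'z : m' ≠ 0 := by
      intro h
      rw [h, form_comm, form_zero_left] at hnm'
      exact hnm hnm'.symm
    have hmem : Projectivization.mk ℝ m' hm'z ∈ circ u ∩ circ w := by
      constructor <;> refine mem_circ_of_mem (mem_mk m' hm'z) hm'z hm'0 ?_
      · simp only [hm', form_sub_right, form_smul_right, hun, hum]; ring
      · simp only [hm', form_sub_right, form_smul_right, hwn, hwm]; ring
    rw [hx] at hmem
    have hmx : Projectivization.mk ℝ m' hm'z = x := hmem
    obtain ⟨c, hc⟩ := exists_smul_of_mem hn hnz (hmx ▸ mem_mk m' hm'z)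
    rw [hc, form_smul_right, hn0, mul_zero] at hnm'
    exact hnm hnm'.symm
  by_contra hD
  have hD' : form u u * form w w - form u w ^ 2 ≠ 0 := sub_ne_zero.2 hD
  apply hnz
  apply eq_zero_of_form_eq_zero
  intro v
  set D := form u u * form w w - form u w ^ 2 with hDdef
  -- This is `D` times the projection of `v` onto the orthogonal complement of `u` and `w`. Since
  -- `n` is orthogonal to both, it would be orthogonal to every `v`.
  have h1 := key (D • v - (form w w * form u v - form u w * form w v) • u
      - (form u u * form w v - form u w * form u v) • w)
    (by simp only [form_sub_right, form_smul_right, hDdef]; ring)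
    (by simp only [form_sub_right, form_smul_right, hDdef, form_comm w u]; ring)
  simp only [form_sub_right, form_smul_right, form_comm n u, form_comm n w, hun, hwn] at h1
  simpa [hD'] using h1

/-- Circles whose poles `u`, `w` satisfy the tangency relation touch at `u + w`. -/
theorem tangent_of_form {u w : V} (hu : form u u = 1 / 8) (hw : form w w = 1 / 8)
    (huw : form u w = -(1 / 8)) (h0 : u + w ≠ 0) :
    circ u ∩ circ w = {Projectivization.mk ℝ (u + w) h0} := by
  have hnull : form (u + w) (u + w) = 0 := by
    simp only [form_add_left, form_add_right, hu, hw, huw, form_comm w u]; norm_num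
  ext x
  constructor
  · rintro ⟨hxu, hxw⟩
    obtain ⟨m, hm, hmt, hm0⟩ := exists_rep_of_lightlike hxu.1
    have h := eq_smul_of_lightlike h0 hnull hm0
      (by rw [form_add_left, hxu.2 m hm, hxw.2 m hm, add_zero])
    refine eq_of_mem_submodule hm ?_ (ne_zero_of_total hmt)
    rw [h]
    exact Submodule.smul_mem _ _ (mem_mk _ _)
  · intro hx
    rw [Set.mem_singleton_iff.1 hx]
    constructor <;> refine mem_circ_of_mem (mem_mk _ h0) h0 hnull ?_
    · rw [form_add_right, hu, huw]; norm_num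
    · rw [form_add_right, hw, form_comm, huw]; norm_num

/-! ### Frames of weights -/

/-- A basis with the Gram matrix of the fundamental weights. -/
structure IsFrame (w : Fin 4 → V) : Prop where
  self : ∀ i, form (w i) (w i) = 1 / 8
  ne : ∀ i j, i ≠ j → form (w i) (w j) = -(1 / 8)
  nondeg : ∀ v, (∀ i, form v (w i) = 0) → v = 0

/-- The frame of fundamental weights. -/
def baseFrame : Fin 4 → V := fun i => Pi.single i 1

/-- The weight replacing `w i` under reflection in the `i`-th simple root. -/
noncomputable def swapVec (i : Fin 4) (w : Fin 4 → V) : V := (2 : ℝ) • ∑ j, w j - (3 : ℝ) • w i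

/-- Reflection of a frame in its `i`-th simple root. -/
noncomputable def swap (i : Fin 4) (w : Fin 4 → V) : Fin 4 → V :=
  Function.update w i (swapVec i w)

theorem form_swapVec (u : V) (i : Fin 4) (w : Fin 4 → V) :
    form u (swapVec i w) = 2 * ∑ j, form u (w j) - 3 * form u (w i) := by
  rw [swapVec, form_sub_right, form_smul_right, form_smul_right, form_sum_right]

theorem swap_same (i : Fin 4) (w : Fin 4 → V) : swap i w i = swapVec i w := by simp [swap]

theorem swap_of_ne {i j : Fin 4} (h : j ≠ i) (w : Fin 4 → V) : swap i w j = w j := by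
  simp [swap, h]

theorem sum_swap (i : Fin 4) (w : Fin 4 → V) :
    ∑ j, swap i w j = (3 : ℝ) • ∑ j, w j - (4 : ℝ) • w i := by
  have h : ∑ j, swap i w j = ∑ j, w j + (swapVec i w - w i) := by
    rw [← Finset.add_sum_erase _ _ (Finset.mem_univ i),
      ← Finset.add_sum_erase _ w (Finset.mem_univ i), swap_same,
      Finset.sum_congr rfl fun j hj => swap_of_ne (Finset.ne_of_mem_erase hj) w]
    abel
  rw [h, swapVec]
  module

theorem swap_swap (i : Fin 4) (w : Fin 4 → V) : swap i (swap i w) = w := by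
  funext j
  by_cases h : j = i
  · subst h
    rw [swap_same, swapVec, sum_swap, swap_same, swapVec]
    module
  · rw [swap_of_ne h, swap_of_ne h]

theorem isFrame_baseFrame : IsFrame baseFrame where
  self i := by
    simp only [form_eq, baseFrame, Fin.sum_univ_four]
    fin_cases i <;> simp <;> norm_num
  ne i j h := by
    simp only [form_eq, baseFrame, Fin.sum_univ_four]
    fin_cases i <;> fin_cases j <;> simp at h ⊢
  nondeg v h := by
    have h0 := h 0
    have h1 := h 1
    have h2 := h 2
    have h3 := h 3
    simp [form_eq, baseFrame, Fin.sum_univ_four] at h0 h1 h2 h3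
    funext i
    fin_cases i <;> simp <;> linarith

namespace IsFrame

variable {w : Fin 4 → V}

theorem sum_form (h : IsFrame w) (i : Fin 4) : ∑ j, form (w i) (w j) = -(1 / 4) := by
  rw [← Finset.add_sum_erase _ _ (Finset.mem_univ i), h.self,
    Finset.sum_congr rfl fun j hj => h.ne i j (Finset.ne_of_mem_erase hj).symm]
  simp [Finset.card_erase_of_mem]
  norm_num

theorem form_swapVec_of_ne (h : IsFrame w) {i j : Fin 4} (hij : j ≠ i) :
    form (w j) (swapVec i w) = -(1 / 8) := by
  rw [form_swapVec, h.sum_form, h.ne j i hij]; norm_num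

theorem form_swapVec_same (h : IsFrame w) (i : Fin 4) :
    form (w i) (swapVec i w) = -(7 / 8) := by
  rw [form_swapVec, h.sum_form, h.self]; norm_num

theorem form_swapVec_swapVec (h : IsFrame w) (i : Fin 4) :
    form (swapVec i w) (swapVec i w) = 1 / 8 := by
  have hs : ∑ j, form (swapVec i w) (w j) = -(10 / 8) := by
    rw [← Finset.add_sum_erase _ _ (Finset.mem_univ i), form_comm, h.form_swapVec_same,
      Finset.sum_congr rfl fun j hj => (form_comm _ _).trans
        (h.form_swapVec_of_ne (Finset.ne_of_mem_erase hj))]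
    simp [Finset.card_erase_of_mem]
    norm_num
  rw [form_swapVec, hs, form_comm, h.form_swapVec_same]
  norm_num

theorem swap (h : IsFrame w) (i : Fin 4) : IsFrame (swap i w) where
  self j := by
    by_cases hj : j = i
    · subst hj; rw [swap_same, h.form_swapVec_swapVec]
    · rw [swap_of_ne hj, h.self]
  ne j k hjk := by
    by_cases hj : j = i
    · subst hj
      rw [swap_same, swap_of_ne hjk.symm, form_comm, h.form_swapVec_of_ne hjk.symm]
    · by_cases hk : k = i
      · subst hk
        rw [swap_same, swap_of_ne hj, h.form_swapVec_of_ne hj]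
      · rw [swap_of_ne hj, swap_of_ne hk, h.ne j k hjk]
  nondeg v hv := by
    have hne : ∀ j, j ≠ i → form v (w j) = 0 := fun j hj => by
      have := hv j
      rwa [swap_of_ne hj] at this
    refine h.nondeg v fun j => ?_
    by_cases hj : j = i
    · subst hj
      have := hv j
      rw [swap_same, form_swapVec, ← Finset.add_sum_erase _ _ (Finset.mem_univ j),
        Finset.sum_eq_zero fun k hk => hne k (Finset.ne_of_mem_erase hk)] at this
      linarith
    · exact hne j hj

theorem ext_form (h : IsFrame w) {u v : V} (huv : ∀ i, form u (w i) = form v (w i)) : u = v :=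
  sub_eq_zero.1 (h.nondeg _ fun i => by rw [form_sub_left, huv, sub_self])

/-- Expansion of a vector in the basis dual to a frame. -/
theorem expand (h : IsFrame w) (v : V) :
    v = (4 : ℝ) • ∑ i, form v (w i) • w i - (2 * ∑ i, form v (w i)) • ∑ i, w i := by
  refine h.ext_form fun k => ?_
  rw [form_comm _ (w k), form_comm (_ - _), form_sub_right, form_smul_right, form_smul_right,
    form_sum_right, form_sum_right, h.sum_form]
  simp only [form_smul_right]
  have : ∑ i, form v (w i) * form (w k) (w i)
      = form v (w k) / 4 - (∑ i, form v (w i)) / 8 := by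
    have hi : ∀ i, form v (w i) * form (w k) (w i)
        = (if i = k then form v (w i) / 4 else 0) - form v (w i) / 8 := by
      intro i
      by_cases hik : i = k
      · subst hik; rw [h.self]; simp; ring
      · rw [h.ne k i (Ne.symm hik)]; simp [hik]; ring
    rw [Finset.sum_congr rfl fun i _ => hi i, Finset.sum_sub_distrib, Finset.sum_div]
    simp
  rw [this, form_comm (w k) v]
  ring

/-- The Gram matrix of the dual basis is the Cartan matrix, so the norm is the Descartes quadratic
form in the products with the frame. -/
theorem form_self_eq (h : IsFrame w) (v : V) :
    form v v = 4 * ∑ i, form v (w i) ^ 2 - 2 * (∑ i, form v (w i)) ^ 2 := by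
  conv_lhs => rw [h.expand v]
  rw [form_comm]
  conv_lhs => rw [form_sub_right, form_smul_right, form_smul_right, form_sum_right, form_sum_right]
  rw [← h.expand v]
  simp only [form_smul_right, pow_two]
  ring

theorem ne_zero (h : IsFrame w) (i : Fin 4) : w i ≠ 0 := by
  intro h0
  have := h.self i
  rw [h0, form_zero_left] at this
  norm_num at this

theorem add_ne_zero (h : IsFrame w) {i j : Fin 4} (hij : i ≠ j) : w i + w j ≠ 0 := by
  obtain ⟨k, hki, hkj⟩ : ∃ k : Fin 4, k ≠ i ∧ k ≠ j := by
    revert i j; decide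
  intro h0
  have : form (w i + w j) (w k) = 0 := by rw [h0, form_zero_left]
  rw [form_add_left, h.ne i k hki.symm, h.ne j k hkj.symm] at this
  norm_num at this

theorem form_add_self (h : IsFrame w) {i j : Fin 4} (hij : i ≠ j) :
    form (w i + w j) (w i + w j) = 0 := by
  simp only [form_add_left, form_add_right, h.self, h.ne i j hij, h.ne j i hij.symm]
  norm_num

theorem form_add_right_eq_zero (h : IsFrame w) {i j : Fin 4} (hij : i ≠ j) :
    form (w i) (w i + w j) = 0 := by
  rw [form_add_right, h.self, h.ne i j hij]
  norm_num

theorem mk_add_mem (h : IsFrame w) {i j : Fin 4} (hij : i ≠ j) :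
    Projectivization.mk ℝ (w i + w j) (h.add_ne_zero hij) ∈ circ (w i) :=
  mem_circ_of_mem (mem_mk _ _) (h.add_ne_zero hij) (h.form_add_self hij)
    (h.form_add_right_eq_zero hij)

theorem tangent (h : IsFrame w) {i j : Fin 4} (hij : i ≠ j) :
    Tangent (circ (w i)) (circ (w j)) :=
  ⟨_, tangent_of_form (h.self i) (h.self j) (h.ne i j hij) (h.add_ne_zero hij)⟩

theorem mk_add_notMem (h : IsFrame w) {i j k : Fin 4} (hij : i ≠ j) (hk : k ≠ i) (hkj : k ≠ j) :
    Projectivization.mk ℝ (w i + w j) (h.add_ne_zero hij) ∉ circ (w k) := by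
  intro hm
  have := hm.2 _ (mem_mk _ _)
  rw [form_add_right, h.ne k i hk, h.ne k j hkj] at this
  norm_num at this

theorem nontrivial (h : IsFrame w) (i : Fin 4) : (circ (w i)).Nontrivial := by
  obtain ⟨j, k, hij, hik, hjk⟩ : ∃ j k : Fin 4, i ≠ j ∧ i ≠ k ∧ j ≠ k := by
    revert i; decide
  refine ⟨_, h.mk_add_mem hij, _, h.mk_add_mem hik, fun he => ?_⟩
  refine h.mk_add_notMem hij hik.symm hjk.symm (he ▸ ?_)
  refine mem_circ_of_mem (mem_mk _ _) (h.add_ne_zero hik) (h.form_add_self hik) ?_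
  rw [add_comm]; exact h.form_add_right_eq_zero hik.symm

/-- The pole of a circle of the frame is determined up to scaling by the circle. -/
theorem eq_smul_of_forall (h : IsFrame w) {i : Fin 4} {v : V}
    (hv : ∀ j, j ≠ i → form v (w i + w j) = 0) : v = (8 * form v (w i)) • w i := by
  refine h.ext_form fun j => ?_
  rw [form_smul_left]
  by_cases hj : j = i
  · subst hj; rw [h.self]; ring
  · rw [h.ne i j (Ne.symm hj)]
    have := hv j hj
    rw [form_add_right] at this
    linarith

theorem eq_smul_of_circ_subset (h : IsFrame w) {i : Fin 4} {v : V} (hv : circ (w i) ⊆ circ v) :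
    v = (8 * form v (w i)) • w i :=
  h.eq_smul_of_forall fun _ hj => (hv (h.mk_add_mem (Ne.symm hj))).2 _ (mem_mk _ _)

end IsFrame

theorem exists_others (i : Fin 4) : ∃ j k l : Fin 4, (i ≠ j ∧ i ≠ k ∧ i ≠ l) ∧
    (j ≠ k ∧ j ≠ l ∧ k ≠ l) ∧ (∀ f : Fin 4 → ℝ, ∑ m, f m = f i + f j + f k + f l) ∧
    ∀ m, m = i ∨ m = j ∨ m = k ∨ m = l := by
  fin_cases i
  · exact ⟨1, 2, 3, by decide, by decide, fun f => by simp [Fin.sum_univ_four], by decide⟩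
  · exact ⟨0, 2, 3, by decide, by decide, fun f => by simp [Fin.sum_univ_four]; ring, by decide⟩
  · exact ⟨0, 1, 3, by decide, by decide, fun f => by simp [Fin.sum_univ_four]; ring, by decide⟩
  · exact ⟨0, 1, 2, by decide, by decide, fun f => by simp [Fin.sum_univ_four]; ring, by decide⟩

/-! ### Uniqueness of the exchanged circle -/

theorem not_tangent_self {S : Set P3} (h : S.Nontrivial) : ¬ Tangent S S := by
  rintro ⟨x, hx⟩
  rw [Set.inter_self] at hx
  exact Set.not_nontrivial_singleton (hx ▸ h)

/-- Solutions of the quadratic relation for a vector of norm `1 / 8` with three products `±1 / 8`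
against a frame. -/
theorem descartes_solutions {x p q r : ℝ} (hp : p = 1 / 8 ∨ p = -(1 / 8))
    (hq : q = 1 / 8 ∨ q = -(1 / 8)) (hr : r = 1 / 8 ∨ r = -(1 / 8))
    (h : 1 / 8 = 4 * (x ^ 2 + p ^ 2 + q ^ 2 + r ^ 2) - 2 * (x + p + q + r) ^ 2) :
    (p = q ∧ p = r ∧ (x = 7 * p ∨ x = -p)) ∨ (x = p ∧ q = p ∧ r = -p) ∨
      (x = p ∧ q = -p ∧ r = p) ∨ (x = q ∧ q = -p ∧ r = -p) := by
  rcases hp with rfl | rfl <;> rcases hq with rfl | rfl <;> rcases hr with rfl | rfl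
  · left
    refine ⟨rfl, rfl, ?_⟩
    have : (x - 7 / 8) * (x + 1 / 8) = 0 := by nlinarith
    rcases mul_eq_zero.1 this with h | h
    · left; linarith
    · right; linarith
  · right; left
    have : (x - 1 / 8) ^ 2 = 0 := by nlinarith
    have := pow_eq_zero_iff two_ne_zero |>.1 this
    refine ⟨by linarith, rfl, rfl⟩
  · right; right; left
    have : (x - 1 / 8) ^ 2 = 0 := by nlinarith
    have := pow_eq_zero_iff two_ne_zero |>.1 this
    refine ⟨by linarith, rfl, rfl⟩
  · right; right; right
    have : (x + 1 / 8) ^ 2 = 0 := by nlinarith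
    have := pow_eq_zero_iff two_ne_zero |>.1 this
    refine ⟨by linarith, rfl, rfl⟩
  · right; right; right
    have : (x - 1 / 8) ^ 2 = 0 := by nlinarith
    have := pow_eq_zero_iff two_ne_zero |>.1 this
    refine ⟨by linarith, by norm_num, by norm_num⟩
  · right; right; left
    have : (x + 1 / 8) ^ 2 = 0 := by nlinarith
    have := pow_eq_zero_iff two_ne_zero |>.1 this
    refine ⟨by linarith, by norm_num, by norm_num⟩
  · right; left
    have : (x + 1 / 8) ^ 2 = 0 := by nlinarith
    have := pow_eq_zero_iff two_ne_zero |>.1 this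
    refine ⟨by linarith, by norm_num, by norm_num⟩
  · left
    refine ⟨rfl, rfl, ?_⟩
    have : (x + 7 / 8) * (x - 1 / 8) = 0 := by nlinarith
    rcases mul_eq_zero.1 this with h | h
    · left; linarith
    · right; linarith

/-- The only circles tangent to three circles of a frame are the fourth circle and the one
obtained from it by reflection. -/
theorem IsFrame.eq_circ_swapVec {w : Fin 4 → V} (h : IsFrame w) {i : Fin 4} {S : Set P3}
    (hS : IsCircle S) (hne : S ≠ circ (w i)) (ht : ∀ j, j ≠ i → Tangent S (circ (w j))) :
    S = circ (swapVec i w) := by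
  obtain ⟨hnt, u₀, hu₀, rfl⟩ := isCircle_iff.1 hS
  have hpos := form_pos_of_nontrivial hu₀ hnt
  obtain ⟨u, hu, hcu⟩ : ∃ u, form u u = 1 / 8 ∧ circ u = circ u₀ := by
    have hc : √(1 / (8 * form u₀ u₀)) ≠ 0 := (Real.sqrt_pos.2 (by positivity)).ne'
    refine ⟨√(1 / (8 * form u₀ u₀)) • u₀, ?_, circ_smul hc _⟩
    rw [form_smul_left, form_smul_right, ← mul_assoc, Real.mul_self_sqrt (by positivity)]
    field_simp
  rw [← hcu] at hnt hne ht ⊢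
  -- With norm 1/8, degeneracy of the Gram matrix leaves only the products ±1/8; the remaining
  -- product solves the Descartes quadratic.
  have hval : ∀ j, j ≠ i → form u (w j) = 1 / 8 ∨ form u (w j) = -(1 / 8) := fun j hj => by
    have := gram_eq_zero_of_tangent (ht j hj)
    rw [hu, h.self] at this
    exact sq_eq_sq_iff_eq_or_eq_neg.1 (by rw [← this]; norm_num)
  have hcirc : ∀ {v : V} {c : ℝ}, c ≠ 0 → (∀ m, form u (w m) = c * form v (w m)) →
      circ u = circ v := fun {v c} hc hv => by
    rw [h.ext_form (u := u) (v := c • v) fun m => by rw [hv, form_smul_left], circ_smul hc]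
  obtain ⟨j, k, l, ⟨hij, hik, hil⟩, ⟨hjk, hjl, hkl⟩, hsum, hall⟩ := exists_others i
  have hself : ∀ m, m ≠ i → circ u ≠ circ (w m) := fun m hm he =>
    not_tangent_self hnt (by simpa [he] using ht m hm)
  have hnorm := h.form_self_eq u
  rw [hsum, hsum, hu] at hnorm
  have hj := hval j hij.symm
  have hj0 : form u (w j) ≠ 0 := by rcases hj with h | h <;> rw [h] <;> norm_num
  have hc8 : -(8 * form u (w j)) ≠ 0 := neg_ne_zero.2 (mul_ne_zero (by norm_num) hj0)
  have hc8' : 8 * form u (w j) ≠ 0 := mul_ne_zero (by norm_num) hj0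
  -- Equal signs give the reflected circle or the original one. With mixed signs the quadratic has a
  -- double root and `u` is, up to sign, the weight with the odd sign, so `S` would be tangent to
  -- itself.
  rcases descartes_solutions hj (hval k hik.symm) (hval l hil.symm) hnorm with
    ⟨h1, h2, h3 | h3⟩ | ⟨h1, h2, h3⟩ | ⟨h1, h2, h3⟩ | ⟨h1, h2, h3⟩
  · refine hcirc hc8 fun m => ?_
    rcases hall m with rfl | rfl | rfl | rfl
    · rw [form_comm (swapVec _ _), h.form_swapVec_same, h3]; ring
    · rw [form_comm (swapVec _ _), h.form_swapVec_of_ne hij.symm]; ring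
    · rw [form_comm (swapVec _ _), h.form_swapVec_of_ne hik.symm, ← h1]; ring
    · rw [form_comm (swapVec _ _), h.form_swapVec_of_ne hil.symm, ← h2]; ring
  · refine (hne (hcirc hc8 fun m => ?_)).elim
    rcases hall m with rfl | rfl | rfl | rfl
    · rw [h.self, h3]; ring
    · rw [h.ne _ _ hij]; ring
    · rw [h.ne _ _ hik, ← h1]; ring
    · rw [h.ne _ _ hil, ← h2]; ring
  · refine (hself l hil.symm (hcirc hc8 fun m => ?_)).elim
    rcases hall m with rfl | rfl | rfl | rfl
    · rw [h.ne _ _ hil.symm, h1]; ring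
    · rw [h.ne _ _ hjl.symm]; ring
    · rw [h.ne _ _ hkl.symm, h2]; ring
    · rw [h.self, h3]; ring
  · refine (hself k hik.symm (hcirc hc8 fun m => ?_)).elim
    rcases hall m with rfl | rfl | rfl | rfl
    · rw [h.ne _ _ hik.symm, h1]; ring
    · rw [h.ne _ _ hjk.symm]; ring
    · rw [h.self, h2]; ring
    · rw [h.ne _ _ hkl, h3]; ring
  · refine (hself j hij.symm (hcirc hc8' fun m => ?_)).elim
    rcases hall m with rfl | rfl | rfl | rfl
    · rw [h.ne _ _ hij.symm, h1, h2]; ring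
    · rw [h.self]; ring
    · rw [h.ne _ _ hjk, h2]; ring
    · rw [h.ne _ _ hjl, h3]; ring

/-! ### The orbit of a frame -/

/-- `Reach w w'`: the frame `w'` is obtained from `w` by finitely many reflections. -/
def Reach : (Fin 4 → V) → (Fin 4 → V) → Prop :=
  Relation.ReflTransGen fun w w' => ∃ i, w' = swap i w

theorem Reach.symm {w w' : Fin 4 → V} (h : Reach w w') : Reach w' w := by
  induction h with
  | refl => exact Relation.ReflTransGen.refl
  | tail _ hs ih =>
    obtain ⟨i, rfl⟩ := hs
    exact Relation.ReflTransGen.head ⟨i, (swap_swap i _).symm⟩ ih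

theorem Reach.swap {w w' : Fin 4 → V} (h : Reach w w') (i : Fin 4) : Reach w (swap i w') :=
  Relation.ReflTransGen.tail h ⟨i, rfl⟩

theorem Reach.isFrame {w w' : Fin 4 → V} (h : Reach w w') (hw : IsFrame w) : IsFrame w' := by
  induction h with
  | refl => exact hw
  | tail _ hs ih =>
    obtain ⟨i, rfl⟩ := hs
    exact ih.swap i

theorem baseCircle_eq (i : Fin 4) : baseCircle i = circ (baseFrame i) := by
  -- The product of `v` with the `i`-th weight is `v i / 4 - total v / 8`.
  refine (circ_eq_of_form_eq (c := -8) (by norm_num) fun v => ?_).symm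
  simp only [form_eq, baseFrame, total, Fin.sum_univ_four]
  fin_cases i <;> simp <;> ring

theorem exists_frame_of_isQuadruple {Q : Fin 4 → Set P3} (h : IsQuadruple Q) :
    ∃ w, Reach baseFrame w ∧ ∀ i, Q i = circ (w i) := by
  induction h with
  | base => exact ⟨baseFrame, Relation.ReflTransGen.refl, baseCircle_eq⟩
  | swap Q i S _ hS hne ht ih =>
    obtain ⟨w, hw, hQ⟩ := ih
    have hf := hw.isFrame isFrame_baseFrame
    refine ⟨swap i w, hw.swap i, fun j => ?_⟩
    by_cases hj : j = i
    · subst hj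
      rw [Function.update_self, swap_same]
      exact hf.eq_circ_swapVec hS (hQ j ▸ hne) fun k hk => hQ k ▸ ht k hk
    · rw [Function.update_of_ne hj, swap_of_ne hj, hQ]

theorem isQuadruple_of_reach {w : Fin 4 → V} (h : Reach baseFrame w) :
    IsQuadruple fun i => circ (w i) := by
  induction h with
  | refl =>
    have : (fun i => circ (baseFrame i)) = baseCircle := funext fun i => (baseCircle_eq i).symm
    rw [this]
    exact IsQuadruple.base
  | @tail w w' hr hs ih =>
    obtain ⟨i, rfl⟩ := hs
    have hf := Reach.isFrame hr isFrame_baseFrame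
    have hf' := hf.swap i
    have he : (fun j => circ (swap i w j))
        = Function.update (fun j => circ (w j)) i (circ (swap i w i)) := by
      funext j
      by_cases hj : j = i
      · subst hj; simp
      · simp [hj, swap_of_ne hj]
    rw [he]
    refine IsQuadruple.swap _ i _ ih
      (isCircle_iff.2 ⟨hf'.nontrivial i, _, hf'.ne_zero i, rfl⟩) ?_ fun j hj => ?_
    · intro hcc
      obtain ⟨j, -, -, ⟨hj, -⟩, -⟩ := exists_others i
      have hm := (hcc ▸ hf'.mk_add_mem hj).2 _ (mem_mk _ _)
      rw [swap_same, swap_of_ne hj.symm, form_add_right, hf.form_swapVec_same,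
        hf.ne i j hj] at hm
      norm_num at hm
    · have := hf'.tangent hj.symm
      rwa [swap_of_ne hj] at this

theorem mem_packing_iff {S : Set P3} :
    S ∈ packing ↔ ∃ w, Reach baseFrame w ∧ ∃ i, S = circ (w i) := by
  constructor
  · rintro ⟨Q, hQ, i, rfl⟩
    obtain ⟨w, hw, h⟩ := exists_frame_of_isQuadruple hQ
    exact ⟨w, hw, i, h i⟩
  · rintro ⟨w, hw, i, rfl⟩
    exact ⟨_, isQuadruple_of_reach hw, i, rfl⟩

/-! ### Separation of the poles -/

/-- Frames obtained from `w₀` by a reduced word, indexed by the last letter of the word. -/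
inductive ReducedReach (w₀ : Fin 4 → V) : Option (Fin 4) → (Fin 4 → V) → Prop
  | refl : ReducedReach w₀ none w₀
  | swap {o : Option (Fin 4)} {w : Fin 4 → V} (k : Fin 4) (h : ReducedReach w₀ o w)
      (hk : o ≠ some k) : ReducedReach w₀ (some k) (swap k w)

theorem Reach.exists_reduced {w₀ w : Fin 4 → V} (h : Reach w₀ w) :
    ∃ o, ReducedReach w₀ o w := by
  induction h with
  | refl => exact ⟨none, ReducedReach.refl⟩
  | tail _ hs ih =>
    obtain ⟨k, rfl⟩ := hs
    obtain ⟨o, ho⟩ := ih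
    by_cases hk : o = some k
    · subst hk
      cases ho with
      -- A repeated last letter cancels, since reflections are involutions.
      | swap _ h' _ => exact ⟨_, by rwa [swap_swap]⟩
    · exact ⟨_, ho.swap k hk⟩

theorem ReducedReach.reach {w₀ w : Fin 4 → V} {o : Option (Fin 4)} (h : ReducedReach w₀ o w) :
    Reach w₀ w := by
  induction h with
  | refl => exact Relation.ReflTransGen.refl
  | swap k _ _ ih => exact ih.swap k

/-- Along a reduced word, either a fixed weight `e` of the initial frame is still present, or all
products with `e` are at most `-1 / 8` and the last letter carries the dominant one. -/
theorem ReducedReach.separation {w₀ w : Fin 4 → V} (h₀ : IsFrame w₀) (m : Fin 4)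
    {o : Option (Fin 4)} (h : ReducedReach w₀ o w) :
    (∃ m', w m' = w₀ m) ∨ ∃ i, o = some i ∧ (∀ j, 1 / 8 ≤ -form (w₀ m) (w j)) ∧
      ∀ j, j ≠ i → -form (w₀ m) (w j) ≤ (∑ j, -form (w₀ m) (w j)) / 2 := by
  induction h with
  | refl => exact Or.inl ⟨m, rfl⟩
  | @swap o w k h hk ih =>
    have hf := h.reach.isFrame h₀
    have hsum : ∑ j, -form (w₀ m) (ApollonianCone.swap k w j)
        = 3 * (∑ j, -form (w₀ m) (w j)) - 4 * -form (w₀ m) (w k) := by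
      simp only [Finset.sum_neg_distrib]
      rw [← form_sum_right, sum_swap, form_sub_right, form_smul_right, form_smul_right,
        form_sum_right]
      ring
    have hnew : -form (w₀ m) (ApollonianCone.swap k w k)
        = 2 * (∑ j, -form (w₀ m) (w j)) - 3 * -form (w₀ m) (w k) := by
      rw [swap_same, form_swapVec, Finset.sum_neg_distrib]; ring
    rcases ih with ⟨m', hm'⟩ | ⟨i, rfl, h1, h2⟩
    · by_cases hkm : m' = k
      · subst hkm
        right
        have hs : ∑ j, -form (w₀ m) (w j) = 1 / 4 := by
          rw [← hm', Finset.sum_neg_distrib, hf.sum_form, neg_neg]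
        rw [hs, ← hm', hf.self] at hsum hnew
        refine ⟨m', rfl, fun j => ?_, fun j hj => ?_⟩
        · by_cases hj : j = m'
          · subst hj; rw [← hm', hnew]; norm_num
          · rw [swap_of_ne hj, ← hm', hf.ne _ _ (Ne.symm hj)]; norm_num
        · rw [← hm', hsum, swap_of_ne hj, hf.ne _ _ (Ne.symm hj)]; norm_num
      · exact Or.inl ⟨m', by rw [swap_of_ne hkm, hm']⟩
    · right
      have hki : k ≠ i := fun he => hk (by rw [he])
      have hk2 := h2 k hki
      -- All the negated products are positive, so two of them are at most the total. With `hk2`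
      -- this shows that reflecting in a letter other than the last makes the new entry dominant.
      have hpair : -form (w₀ m) (w i) + -form (w₀ m) (w k) ≤ ∑ j, -form (w₀ m) (w j) := by
        rw [← Finset.sum_pair (f := fun j => -form (w₀ m) (w j)) hki.symm]
        exact Finset.sum_le_univ_sum_of_nonneg fun j => by linarith [h1 j]
      refine ⟨k, rfl, fun j => ?_, fun j hj => ?_⟩
      · by_cases hj : j = k
        · subst hj; rw [hnew]; linarith [h1 j]
        · rw [swap_of_ne hj]; exact h1 j
      · rw [hsum, swap_of_ne hj]
        by_cases hji : j = i
        · subst hji; linarith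
        · linarith [h2 j hji]

/-- Reflections are reversible, so `w` can serve as the initial frame in `ReducedReach.separation`.
-/
theorem Reach.eq_or_form_le {w w' : Fin 4 → V} (hw : Reach baseFrame w)
    (hw' : Reach baseFrame w') (i j : Fin 4) :
    w i = w' j ∨ form (w i) (w' j) ≤ -(1 / 8) := by
  have hf := hw.isFrame isFrame_baseFrame
  have hr : Reach w w' := Relation.ReflTransGen.trans hw.symm hw'
  have hf' := hr.isFrame hf
  obtain ⟨o, ho⟩ := hr.exists_reduced
  rcases ho.separation hf i with ⟨m, hm⟩ | ⟨_, -, h, -⟩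
  · rw [← hm]
    by_cases hmj : m = j
    · left; rw [hmj]
    · right; rw [hf'.ne m j hmj]
  · right; linarith [h j]

theorem total_eq_form (v : V) : total v = -4 * ∑ i, form (baseFrame i) v := by
  rw [total_apply]
  simp [form_eq, baseFrame, Fin.sum_univ_four]
  ring

/-- The total is -4 times the sum of the products with the base weights, all negative by separation
unless the weight is itself a base weight. Hence the apexes lie in the affine section, and positive
products single out the caps facing them. -/
theorem Reach.total_pos {w : Fin 4 → V} (hw : Reach baseFrame w) (i : Fin 4) :
    0 < total (w i) := by
  have h := fun j => Reach.eq_or_form_le Relation.ReflTransGen.refl hw j i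
  by_cases hj : ∃ j, baseFrame j = w i
  · obtain ⟨j, hj⟩ := hj
    rw [← hj, total_apply]
    simp [baseFrame]
  · push Not at hj
    have h' := fun j => (h j).resolve_left (hj j)
    rw [total_eq_form, Fin.sum_univ_four]
    linarith [h' 0, h' 1, h' 2, h' 3]

/-! ### Density of the packing -/

/-- With `s = a + b + c` the relation reads `q = 2 (d - s)² - 8 (ab + bc + ca)`. If `d ≤ s`,
maximality of `d` would force `q ≤ 0`; so `d > s`, and dropping the last term gives the bound. -/
theorem descent_gap {a b c d q : ℝ} (ha : 0 ≤ a) (hb : 0 ≤ b) (hc : 0 ≤ c) (had : a ≤ d)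
    (hbd : b ≤ d) (hcd : c ≤ d) (hq : 0 < q)
    (h : q = 4 * (d ^ 2 + a ^ 2 + b ^ 2 + c ^ 2) - 2 * (d + a + b + c) ^ 2) :
    √(q / 2) ≤ d - (a + b + c) := by
  have hlt : a + b + c < d := by
    by_contra! hle
    rcases le_total a c with h1 | h1 <;> rcases le_total b c with h2 | h2 <;>
      rcases le_total a b with h3 | h3 <;>
      nlinarith [mul_nonneg (sub_nonneg.2 had) (sub_nonneg.2 hle),
        mul_nonneg (sub_nonneg.2 hbd) (sub_nonneg.2 hle),
        mul_nonneg (sub_nonneg.2 hcd) (sub_nonneg.2 hle),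
        mul_nonneg ha hb, mul_nonneg hb hc, mul_nonneg ha hc]
  rw [Real.sqrt_le_left (by linarith)]
  nlinarith [mul_nonneg ha hb, mul_nonneg hb hc, mul_nonneg ha hc]

/-- Every spacelike vector has a positive product with some weight of the orbit. -/
theorem exists_form_pos {x : V} (hx : 0 < form x x) :
    ∃ w, Reach baseFrame w ∧ ∃ i, 0 < form x (w i) := by
  by_contra! hneg
  have hε : 0 < √(form x x / 2) := Real.sqrt_pos.2 (by linarith)
  -- Reflecting at the largest negated product lowers the sum by `2 (d - s)`, at least a fixed
  -- positive amount, whereas the sum stays nonnegative.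
  have hdesc : ∀ n : ℕ, ∃ w, Reach baseFrame w ∧
      ∑ i, -form x (w i) ≤ ∑ i, -form x (baseFrame i) - n * √(form x x / 2) := by
    intro n
    induction n with
    | zero => exact ⟨baseFrame, Relation.ReflTransGen.refl, by simp⟩
    | succ n ih =>
      obtain ⟨w, hw, hle⟩ := ih
      have hf := hw.isFrame isFrame_baseFrame
      obtain ⟨i, hi⟩ := Finite.exists_max fun i => -form x (w i)
      refine ⟨swap i w, hw.swap i, ?_⟩
      obtain ⟨j, k, l, -, -, hsum, -⟩ := exists_others i
      have hn := fun i => neg_nonneg.2 (hneg w hw i)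
      have hgap := descent_gap (hn j) (hn k) (hn l) (hi j) (hi k) (hi l) hx (by
        rw [hf.form_self_eq x, hsum, hsum]; ring)
      have hs : ∑ m, -form x (swap i w m)
          = 3 * (∑ m, -form x (w m)) - 4 * -form x (w i) := by
        simp only [Finset.sum_neg_distrib]
        rw [← form_sum_right, sum_swap, form_sub_right, form_smul_right, form_smul_right,
          form_sum_right]
        ring
      rw [hs]
      rw [hsum fun m => -form x (w m)] at hle ⊢
      push_cast
      linarith
  obtain ⟨n, hn⟩ := exists_nat_gt ((∑ i, -form x (baseFrame i)) / √(form x x / 2))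
  rw [div_lt_iff₀ hε] at hn
  obtain ⟨w, hw, hle⟩ := hdesc n
  have := Finset.sum_nonneg fun i (_ : i ∈ Finset.univ) => neg_nonneg.2 (hneg w hw i)
  linarith

/-! ### Tangent cones -/

theorem IsFrame.isTangentApex_iff {w : Fin 4 → V} (h : IsFrame w) (i : Fin 4) (p : P3) :
    IsTangentApex p (circ (w i)) ↔ w i ∈ p.submodule := by
  constructor
  · intro hp
    set P := p.rep with hP
    have hPp : P ∈ p.submodule := rep_mem p
    have hP0 : P ≠ 0 := p.rep_nonzero
    -- Otherwise the line from `P` to the tangency point `n` would meet `N` again, at `z`.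
    -- Orthogonality to three such points determines the pole.
    have horth : ∀ j, j ≠ i → form P (w i + w j) = 0 := by
      intro j hj
      have hn0 := h.add_ne_zero (Ne.symm hj)
      have hnn := h.form_add_self (Ne.symm hj)
      obtain ⟨hne, hx⟩ := hp _ (h.mk_add_mem (Ne.symm hj))
      set n := w i + w j
      by_contra hPn
      set z := P - (form P P / (2 * form P n)) • n with hz
      have hznull : form z z = 0 := by
        simp only [hz, form_sub_left, form_sub_right, form_smul_left, form_smul_right, hnn,
          form_comm n P]
        field_simp
        ring
      have hzn : form z n = form P n := by
        simp only [hz, form_sub_left, form_smul_left, hnn]; ring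
      have hz0 : z ≠ 0 := by
        intro h0
        rw [h0, form_zero_left] at hzn
        exact hPn hzn.symm
      have hzp : z ∈ p.submodule ⊔ (Projectivization.mk ℝ n hn0).submodule :=
        Submodule.sub_mem _ (Submodule.mem_sup_left hPp)
          (Submodule.mem_sup_right (Submodule.smul_mem _ _ (mem_mk n hn0)))
      have heq := hx (Projectivization.mk ℝ z hz0)
        (mem_lightlike_of_mem (mem_mk z hz0) hz0 hznull) (by
          rw [Projectivization.submodule_mk, Submodule.span_le]
          simpa using hzp)
      obtain ⟨c, hc⟩ := exists_smul_of_mem (mem_mk n hn0) hn0 (heq ▸ mem_mk z hz0)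
      rw [hc, form_smul_left, hnn, mul_zero] at hzn
      exact hPn hzn.symm
    have hPw := h.eq_smul_of_forall horth
    have hc : 8 * form P (w i) ≠ 0 := by
      intro h0
      rw [h0, zero_smul] at hPw
      exact hP0 hPw
    have : w i = (8 * form P (w i))⁻¹ • P := by
      conv_rhs => rw [hPw]
      rw [form_smul_left, h.self, smul_smul]
      have : (8 * (8 * form P (w i) * (1 / 8)))⁻¹ * (8 * form P (w i)) = 1 := by
        field_simp
        exact div_self (by simpa using hc)
      rw [this, one_smul]
    rw [this]
    exact Submodule.smul_mem _ _ hPp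
  · intro hp q hq
    obtain ⟨b, hb, hbt, hb0⟩ := exists_rep_of_lightlike hq.1
    have hwb := hq.2 b hb
    refine ⟨?_, fun x hx hle => ?_⟩
    · rintro rfl
      have := hq.1 _ hp
      rw [h.self] at this
      norm_num at this
    · have hxl := hle (rep_mem x)
      obtain ⟨y, hy, z, hz, hyz⟩ := Submodule.mem_sup.1 hxl
      obtain ⟨c, rfl⟩ := exists_smul_of_mem hp (h.ne_zero i) hy
      obtain ⟨d, rfl⟩ := exists_smul_of_mem hb (ne_zero_of_total hbt) hz
      have hx0 := hx _ (rep_mem x)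
      rw [← hyz] at hx0
      simp only [form_add_left, form_add_right, form_smul_left, form_smul_right,
        form_comm b (w i), hwb, hb0, h.self] at hx0
      have hc : c = 0 := by
        have : c ^ 2 = 0 := by linarith
        exact pow_eq_zero_iff two_ne_zero |>.1 this
      rw [hc, zero_smul, zero_add] at hyz
      exact eq_of_mem_submodule (rep_mem x) (hyz ▸ hz) x.rep_nonzero

/-! ### Cones and caps in terms of the form -/

theorem mem_cap_iff_of_mem {u b : V} {r : P3} (hb : b ∈ r.submodule) (hbt : total b = 1) :
    r ∈ cap u ↔ form b b = 0 ∧ 0 < form u b := by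
  constructor
  · rintro ⟨hr, v, hv, hvt, h⟩
    rw [eq_of_total hb hv hbt hvt] at h
    exact ⟨hr b hb, h⟩
  · rintro ⟨h0, h⟩
    exact ⟨mem_lightlike_of_mem hb (ne_zero_of_total hbt) h0, b, hb, hbt, h⟩

theorem mem_unboundedCone_iff {u : V} {p x : P3} (hp : u ∈ p.submodule) (hu : 0 < total u) :
    x ∈ unboundedCone p (cap u) ↔ ∃ b, ∃ t : ℝ, total b = 1 ∧ form b b = 0 ∧ 0 < form u b ∧ 0 < t ∧
      (1 - t) • ((total u)⁻¹ • u) + t • b ∈ x.submodule := by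
  have hup : (total u)⁻¹ • u ∈ p.submodule := p.submodule.smul_mem _ hp
  have hut : total ((total u)⁻¹ • u) = 1 := by simp [hu.ne']
  constructor
  · rintro ⟨a, ha, r, hr, b, hb, hat, hbt, t, ht, hx⟩
    obtain ⟨h0, h1⟩ := (mem_cap_iff_of_mem hb hbt).1 hr
    rw [eq_of_total hup ha hut hat] at hx
    exact ⟨b, t, hbt, h0, h1, ht, hx⟩
  · rintro ⟨b, t, hbt, h0, h1, ht, hx⟩
    exact ⟨_, hup, _, (mem_cap_iff_of_mem (mem_mk b (ne_zero_of_total hbt)) hbt).2 ⟨h0, h1⟩,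
      b, mem_mk _ _, hut, hbt, t, ht, hx⟩

theorem mem_boundedCone_iff {u : V} {p x : P3} (hp : u ∈ p.submodule) (hu : 0 < total u) :
    x ∈ boundedCone p (cap u) ↔ ∃ b, ∃ t : ℝ, total b = 1 ∧ form b b = 0 ∧ 0 < form u b ∧ 0 < t ∧
      t ≤ 1 ∧ (1 - t) • ((total u)⁻¹ • u) + t • b ∈ x.submodule := by
  have hup : (total u)⁻¹ • u ∈ p.submodule := p.submodule.smul_mem _ hp
  have hut : total ((total u)⁻¹ • u) = 1 := by simp [hu.ne']
  constructor
  · rintro ⟨a, ha, r, hr, b, hb, hat, hbt, t, ht, ht1, hx⟩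
    obtain ⟨h0, h1⟩ := (mem_cap_iff_of_mem hb hbt).1 hr
    rw [eq_of_total hup ha hut hat] at hx
    exact ⟨b, t, hbt, h0, h1, ht, ht1, hx⟩
  · rintro ⟨b, t, hbt, h0, h1, ht, ht1, hx⟩
    exact ⟨_, hup, _, (mem_cap_iff_of_mem (mem_mk b (ne_zero_of_total hbt)) hbt).2 ⟨h0, h1⟩,
      b, mem_mk _ _, hut, hbt, t, ht, ht1, hx⟩

theorem total_cone_point {u b : V} (hu : 0 < total u) (hb : total b = 1) (t : ℝ) :
    total ((1 - t) • ((total u)⁻¹ • u) + t • b) = 1 := by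
  simp [hu.ne', hb]

theorem boundedCone_subset_unboundedCone (p : P3) (R : Set P3) :
    boundedCone p R ⊆ unboundedCone p R := by
  rintro x ⟨a, ha, r, hr, b, hb, hat, hbt, t, ht, -, hx⟩
  exact ⟨a, ha, r, hr, b, hb, hat, hbt, t, ht, hx⟩

/-- A point whose line through the apex crosses `N` transversally, and which is not beyond the
apex as seen from `N`, lies in the unbounded cone. -/
theorem mem_unboundedCone_of_discrim {u y : V} {p x : P3} (hp : u ∈ p.submodule)
    (hut : 0 < total u) (huu : 0 < form u u) (hy : y ∈ x.submodule) (hyt : total y = 1)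
    (hD : form u u * form y y < form u y ^ 2) (h : form y y ≤ 0 ∨ form u y < 0) :
    x ∈ unboundedCone p (cap u) := by
  set D := form u y ^ 2 - form u u * form y y with hDdef
  have hDpos : 0 < D := sub_pos.2 hD
  have hroot := Real.sq_sqrt hDpos.le
  have hrpos := Real.sqrt_pos.2 hDpos
  -- The larger root of `(y + l u, y + l u) = 0`, for which `(u, y + l u) = √D > 0`: the
  -- intersection with `N` on the cap side.
  set l := (√D - form u y) / form u u with hl
  have hlu : l * form u u = √D - form u y := div_mul_cancel₀ _ huu.ne'
  have hl0 : 0 ≤ l := by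
    refine div_nonneg ?_ huu.le
    rcases h with h | h
    · rw [sub_nonneg]
      refine Real.le_sqrt_of_sq_le ?_
      nlinarith
    · linarith
  have hquad : form u u * l ^ 2 + 2 * l * form u y + form y y = 0 := by
    have : form u u * (form u u * l ^ 2 + 2 * l * form u y + form y y) = 0 := by
      have h1 : form u u * (form u u * l ^ 2 + 2 * l * form u y + form y y)
        = (l * form u u) ^ 2 + 2 * (l * form u u) * form u y + form u u * form y y := by ring
      rw [h1, hlu]
      nlinarith
    exact (mul_eq_zero.1 this).resolve_left huu.ne'
  have ht : 0 < 1 + l * total u := by positivity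
  refine (mem_unboundedCone_iff hp hut).2 ⟨(1 + l * total u)⁻¹ • (y + l • u), 1 + l * total u,
    ?_, ?_, ?_, ht, ?_⟩
  · simp only [map_smul, map_add, hyt, smul_eq_mul]
    exact inv_mul_cancel₀ ht.ne'
  · have : form (y + l • u) (y + l • u) = 0 := by
      simp only [form_add_left, form_add_right, form_smul_left, form_smul_right, form_comm y u]
      linarith
    rw [form_smul_left, form_smul_right, this, mul_zero, mul_zero]
  · rw [form_smul_right, form_add_right, form_smul_right, hlu]
    refine mul_pos (inv_pos.2 ht) ?_
    linarith
  · convert hy using 1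
    rw [smul_inv_smul₀ ht.ne', smul_smul]
    have : (1 - (1 + l * total u)) * (total u)⁻¹ = -l := by
      field_simp
      ring
    rw [this]
    module

theorem cap_nonempty {u : V} (hu : 0 < form u u) : (cap u).Nonempty := by
  set c : V := 1 with hc
  have htc : total c = 4 := by simp [total_apply, hc]
  have hcv : ∀ v, form c v = -(total v / 4) := fun v => by
    rw [form_eq, total_apply]
    simp [hc]
    ring
  -- The component of `u` orthogonal to the timelike vector `c`, the centre of the sphere; `b` is
  -- the point of `N` in the direction `z`.
  set z := u - (total u / 4) • c with hz
  have htz : total z = 0 := by simp [hz, htc]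
  have hzu : form z u = form u u + total u ^ 2 / 16 := by
    rw [hz, form_sub_left, form_smul_left, hcv]; ring
  have hzz : form z z = form u u + total u ^ 2 / 16 := by
    conv_lhs => rw [hz]
    rw [form_sub_left, form_smul_left, hcv, htz, form_comm, hzu]; ring
  set E := form u u + total u ^ 2 / 16 with hE
  have hEpos : 0 < E := by positivity
  have hr := Real.sqrt_pos.2 hEpos
  have hr2 := Real.sq_sqrt hEpos.le
  set b := (1 / 4 : ℝ) • (c + (√E)⁻¹ • z) with hb
  have hbt : total b = 1 := by simp [hb, htc, htz]
  refine ⟨_, (mem_cap_iff_of_mem (mem_mk b (ne_zero_of_total hbt)) hbt).2 ⟨?_, ?_⟩⟩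
  · have : form (c + (√E)⁻¹ • z) (c + (√E)⁻¹ • z) = 0 := by
      simp only [form_add_left, form_add_right, form_smul_left, form_smul_right, form_comm z c,
        hcv, htz, htc, hzz]
      field_simp
      linarith
    rw [hb, form_smul_left, form_smul_right, this, mul_zero, mul_zero]
  · rw [hb, form_smul_right, form_comm, form_add_left, form_smul_left, hzu, hcv]
    have h1 : (√E)⁻¹ * E = √E := by
      rw [inv_mul_eq_div, Real.div_sqrt]
    rw [h1]
    have h2 : total u / 4 < √E := Real.lt_sqrt_of_sq_lt (by rw [hE]; linarith [div_pow (total u) 4 2])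
    linarith

/-- Poles of caps at least tangent from outside have oppositely signed products with any point
of `N` in one of the caps. -/
theorem form_add_nonpos {u v b : V} (hu : form u u = 1 / 8) (hv : form v v = 1 / 8)
    (hut : 0 < total u) (hvt : 0 < total v) (huv : form u v ≤ -(1 / 8)) (hb : form b b = 0)
    (hbt : total b = 1) : form u b + form v b ≤ 0 := by
  rw [← form_add_left, form_comm]
  refine form_nonpos_of_causal hb (by linarith) ?_ (by rw [map_add]; linarith)
  -- Separation makes `u + v` causal.
  simp only [form_add_left, form_add_right, form_comm v u]
  linarith

theorem cap_subset_cap_neg {u v : V} (hu : form u u = 1 / 8) (hv : form v v = 1 / 8)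
    (hut : 0 < total u) (hvt : 0 < total v) (huv : form u v ≤ -(1 / 8)) :
    cap v ⊆ cap (-u) := by
  rintro x ⟨hx, b, hb, hbt, hvb⟩
  refine ⟨hx, b, hb, hbt, ?_⟩
  have := form_add_nonpos hu hv hut hvt huv (hx b hb) hbt
  rw [← neg_one_smul ℝ u, form_smul_left]
  linarith

theorem disjoint_cap_cap_neg (u : V) : Disjoint (cap u) (cap (-u)) := by
  rw [Set.disjoint_left]
  rintro x ⟨_, b, hb, hbt, h⟩ ⟨_, b', hb', hbt', h'⟩
  rw [eq_of_total hb hb' hbt hbt', ← neg_one_smul ℝ u, form_smul_left] at h'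
  linarith

theorem boundedCone_subset_of_separated {u v : V} {p q : P3} (hp : u ∈ p.submodule)
    (hq : v ∈ q.submodule) (hu : form u u = 1 / 8) (hv : form v v = 1 / 8)
    (hut : 0 < total u) (hvt : 0 < total v) (huv : form u v ≤ -(1 / 8)) :
    boundedCone q (cap v) ⊆ unboundedCone p (cap u) := by
  intro x hx
  obtain ⟨b, t, hbt, hb, hvb, ht, ht1, hy⟩ := (mem_boundedCone_iff hq hvt).1 hx
  have hub := form_add_nonpos hu hv hut hvt huv hb hbt
  have hyt := total_cone_point hvt hbt t
  rw [smul_smul] at hy hyt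
  set a := (1 - t) * (total v)⁻¹ with ha
  have ha0 : 0 ≤ a := mul_nonneg (by linarith) (inv_nonneg.2 hvt.le)
  have huy : form u (a • v + t • b) ≤ -(a / 8 + t * form v b) := by
    rw [form_add_right, form_smul_right, form_smul_right]
    nlinarith [mul_le_mul_of_nonneg_left huv ha0]
  have hm : 0 < t * form v b := mul_pos ht hvb
  refine mem_unboundedCone_of_discrim hp hut (by rw [hu]; norm_num) hy hyt ?_
    (Or.inr (by linarith))
  have hyy : form (a • v + t • b) (a • v + t • b) = a ^ 2 / 8 + 2 * a * (t * form v b) := by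
    simp only [form_add_left, form_add_right, form_smul_left, form_smul_right, form_comm b v, hv,
      hb]
    ring
  rw [hu, hyy]
  have h1 : (a / 8 + t * form v b) ^ 2 ≤ form u (a • v + t • b) ^ 2 := by
    rw [← neg_sq (form u _)]
    exact pow_le_pow_left₀ (by linarith [div_nonneg ha0 (by norm_num : (0 : ℝ) ≤ 8)])
      (by linarith) 2
  -- With `m = t (v,b)`, the discriminant is at least `(a/8 + m)² - (a²/8 + 2am)/8 = m²`.
  nlinarith [pow_pos hm 2]

/-- A spacelike point of the unbounded cone on the positive side of the polar plane of the apex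
lies in the bounded cone. -/
theorem mem_boundedCone_of_spacelike {u y : V} {p x : P3} (hp : u ∈ p.submodule)
    (hut : 0 < total u) (hx : x ∈ unboundedCone p (cap u))
    (hy : y ∈ x.submodule) (hyt : total y = 1) (hyy : 0 < form y y) (huy : 0 < form u y) :
    x ∈ boundedCone p (cap u) := by
  obtain ⟨b, t, hbt, hb, hub, ht, hmem⟩ := (mem_unboundedCone_iff hp hut).1 hx
  refine (mem_boundedCone_iff hp hut).2 ⟨b, t, hbt, hb, hub, ht, ?_, hmem⟩
  rw [eq_of_total hmem hy (total_cone_point hut hbt t) hyt, smul_smul] at hyy huy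
  by_contra! ht1
  set a := (1 - t) * (total u)⁻¹ with ha
  have ha0 : a < 0 := mul_neg_of_neg_of_pos (by linarith) (inv_pos.2 hut)
  simp only [form_add_left, form_add_right, form_smul_left, form_smul_right, form_comm b u, hb]
    at hyy huy
  have hm : 0 < t * form u b := mul_pos ht hub
  -- Here `(y,y) = a ((u,y) + t (u,b))`, negative when `a < 0`.
  nlinarith [mul_pos (neg_pos.2 ha0) hm, mul_pos (neg_pos.2 ha0) huy]

theorem notMem_unboundedCone_of_mem_circ {u : V} {p x : P3} (hp : u ∈ p.submodule)
    (hut : 0 < total u) (hx : x ∈ circ u) :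
    x ∉ unboundedCone p (cap u) := by
  intro h
  obtain ⟨b, t, hbt, hb, hub, ht, hmem⟩ := (mem_unboundedCone_iff hp hut).1 h
  have h1 := hx.2 _ hmem
  have h2 := hx.1 _ hmem
  rw [smul_smul] at h1 h2
  set a := (1 - t) * (total u)⁻¹
  simp only [form_add_left, form_add_right, form_smul_left, form_smul_right, form_comm b u, hb]
    at h1 h2
  have hm : 0 < t * form u b := mul_pos ht hub
  have ha : a * (t * form u b) = 0 := by linear_combination h2 - a * h1
  rcases mul_eq_zero.1 ha with h | h
  · rw [h] at h1; linarith
  · exact hm.ne' h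

theorem cap_subset_boundedCone {u : V} {p : P3} (hp : u ∈ p.submodule) (hut : 0 < total u) :
    cap u ⊆ boundedCone p (cap u) := by
  rintro x ⟨hx, b, hb, hbt, h⟩
  refine (mem_boundedCone_iff hp hut).2 ⟨b, 1, hbt, hx b hb, h, one_pos, le_rfl, ?_⟩
  simpa using hb

/-! ### The poles of the packing -/

/-- The weights of the orbit, normalised as poles of the circles of the packing. -/
structure IsPole (u : V) (S : Set P3) : Prop where
  exists_frame : ∃ w, Reach baseFrame w ∧ ∃ i, w i = u
  circ_eq : S = circ u

namespace IsPole

variable {u v : V} {S T : Set P3}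

theorem form_self (h : IsPole u S) : form u u = 1 / 8 := by
  obtain ⟨w, hw, i, rfl⟩ := h.exists_frame
  exact (hw.isFrame isFrame_baseFrame).self i

theorem form_self_pos (h : IsPole u S) : 0 < form u u := by
  rw [h.form_self]; norm_num

theorem total_pos (h : IsPole u S) : 0 < total u := by
  obtain ⟨w, hw, i, rfl⟩ := h.exists_frame
  exact hw.total_pos i

theorem ne_zero (h : IsPole u S) : u ≠ 0 := by
  rintro rfl
  simpa using h.total_pos

theorem form_le (h : IsPole u S) (h' : IsPole v T) (hST : S ≠ T) : form u v ≤ -(1 / 8) := by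
  obtain ⟨w, hw, i, rfl⟩ := h.exists_frame
  obtain ⟨w', hw', j, rfl⟩ := h'.exists_frame
  refine (hw.eq_or_form_le hw' i j).resolve_left fun he => hST ?_
  rw [h.circ_eq, h'.circ_eq, he]

theorem isTangentApex_iff (h : IsPole u S) (p : P3) : IsTangentApex p S ↔ u ∈ p.submodule := by
  rw [h.circ_eq]
  obtain ⟨w, hw, i, rfl⟩ := h.exists_frame
  exact (hw.isFrame isFrame_baseFrame).isTangentApex_iff i p

theorem cap_subset_cap_neg (h : IsPole u S) (h' : IsPole v T) (hST : S ≠ T) :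
    cap v ⊆ cap (-u) :=
  ApollonianCone.cap_subset_cap_neg h.form_self h'.form_self h.total_pos h'.total_pos
    (h.form_le h' hST)

theorem isOpenCap_iff (h : IsPole u S) {O : Set P3} (hO : IsOpenCap O S) :
    O = cap u ∨ O = cap (-u) := by
  obtain ⟨v, hv, hS, rfl⟩ := ApollonianCone.isOpenCap_iff.1 hO
  rw [h.circ_eq] at hS
  obtain ⟨c, rfl⟩ : ∃ c : ℝ, v = c • u := by
    obtain ⟨w, hw, i, rfl⟩ := h.exists_frame
    exact ⟨_, (hw.isFrame isFrame_baseFrame).eq_smul_of_circ_subset hS.le⟩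
  rcases lt_trichotomy c 0 with hc | rfl | hc
  · right
    rw [← neg_smul_neg, cap_smul (neg_pos.2 hc)]
  · simp at hv
  · left
    rw [cap_smul hc]

end IsPole

theorem exists_isPole {S : Set P3} (hS : S ∈ packing) : ∃ u, IsPole u S := by
  obtain ⟨w, hw, i, rfl⟩ := mem_packing_iff.1 hS
  exact ⟨w i, ⟨w, hw, i, rfl⟩, rfl⟩

theorem exists_two_others {S : Set P3} (hS : S ∈ packing) :
    ∃ T ∈ packing, ∃ U ∈ packing, S ≠ T ∧ S ≠ U ∧ T ≠ U := by
  obtain ⟨w, hw, i, rfl⟩ := mem_packing_iff.1 hS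
  have hf := hw.isFrame isFrame_baseFrame
  have hmem := fun j => mem_packing_iff.2 ⟨w, hw, j, rfl⟩
  have hne : ∀ j k, j ≠ k → circ (w j) ≠ circ (w k) := by
    intro j k hjk he
    obtain ⟨l, hlj, hlk⟩ : ∃ l : Fin 4, l ≠ j ∧ l ≠ k := by
      clear he; revert j k; decide
    exact hf.mk_add_notMem hlj.symm hjk.symm hlk.symm (he ▸ hf.mk_add_mem hlj.symm)
  obtain ⟨j, k, l, ⟨hij, hik, -⟩, ⟨hjk, -⟩, -⟩ := exists_others i
  exact ⟨_, hmem j, _, hmem k, hne _ _ hij, hne _ _ hik, hne _ _ hjk⟩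

/-- The caps of a cap system are the caps facing the poles. -/
theorem IsCapSystem.eq_cap {O : packing → Set P3} (hO : IsCapSystem O) {S : packing} {u : V}
    (hu : IsPole u S) : O S = cap u := by
  refine (hu.isOpenCap_iff (hO.isOpenCap S)).resolve_right fun hS => ?_
  -- A cap on the wrong side of `S` contains the positive cap of every other circle. So it meets
  -- either choice for `T`: the positive cap of `T` itself, or its complementary cap, which also
  -- contains that of `U`.
  obtain ⟨T, hT, U, hU, hST, hSU, hTU⟩ := exists_two_others S.2
  obtain ⟨v, hv⟩ := exists_isPole hT
  obtain ⟨z, hz⟩ := exists_isPole hU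
  have hdisj := hO.disjoint S ⟨T, hT⟩ fun he => hST (congrArg Subtype.val he)
  rw [hS] at hdisj
  rcases hv.isOpenCap_iff (hO.isOpenCap ⟨T, hT⟩) with h | h
  · rw [h] at hdisj
    obtain ⟨x, hx⟩ := cap_nonempty hv.form_self_pos
    exact Set.disjoint_left.1 hdisj (hu.cap_subset_cap_neg hv hST hx) hx
  · rw [h] at hdisj
    obtain ⟨x, hx⟩ := cap_nonempty hz.form_self_pos
    exact Set.disjoint_left.1 hdisj (hu.cap_subset_cap_neg hz hSU hx)
      (hv.cap_subset_cap_neg hz hTU hx)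

theorem exists_isCapSystem : ∃ O : packing → Set P3, IsCapSystem O := by
  choose u hu using fun S : packing => exists_isPole S.2
  refine ⟨fun S => cap (u S), fun S => ?_, fun S T hST => ?_⟩
  · rw [(hu S).circ_eq]
    exact isOpenCap_cap (hu S).ne_zero
  · have := (hu S).cap_subset_cap_neg (hu T) (Subtype.coe_ne_coe.2 hST)
    exact (disjoint_cap_cap_neg (u S)).mono_right this

/-! ### The intersection of the unbounded cones -/

theorem iInter_unboundedCone_eq {O : packing → Set P3} {p : packing → P3} (hO : IsCapSystem O)
    (hp : ∀ S : packing, IsTangentApex (p S) S) :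
    (⋂ S : packing, unboundedCone (p S) (O S)) =
      timelike ∪ residualSet O ∪ ⋃ S : packing, boundedCone (p S) (O S) := by
  choose u hu using fun S : packing => exists_isPole S.2
  have hcap : ∀ S, O S = cap (u S) := fun S => hO.eq_cap (hu S)
  have hup : ∀ S, u S ∈ (p S).submodule := fun S => ((hu S).isTangentApex_iff _).1 (hp S)
  simp only [hcap]
  apply Set.Subset.antisymm
  · intro x hx
    rw [Set.mem_iInter] at hx
    obtain ⟨S₀⟩ : Nonempty packing :=
      ⟨⟨_, mem_packing_iff.2 ⟨baseFrame, Relation.ReflTransGen.refl, 0, rfl⟩⟩⟩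
    obtain ⟨y, hy, hyt⟩ : ∃ y ∈ x.submodule, total y = 1 := by
      obtain ⟨b, t, hbt, -, -, -, hmem⟩ :=
        (mem_unboundedCone_iff (hup S₀) (hu S₀).total_pos).1 (hx S₀)
      exact ⟨_, hmem, total_cone_point (hu S₀).total_pos hbt t⟩
    rcases lt_trichotomy (form y y) 0 with h | h | h
    · exact Or.inl (Or.inl ⟨y, hy, h⟩)
    · have hxl := mem_lightlike_of_mem hy (ne_zero_of_total hyt) h
      by_cases hin : ∃ S, x ∈ cap (u S)
      · obtain ⟨S, hS⟩ := hin
        exact Or.inr (Set.mem_iUnion.2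
          ⟨S, cap_subset_boundedCone (hup S) (hu S).total_pos hS⟩)
      · push Not at hin
        refine Or.inl (Or.inr ⟨hxl, fun S => ⟨fun hS => ?_, by rw [hcap]; exact hin S⟩⟩)
        rw [(hu S).circ_eq] at hS
        exact notMem_unboundedCone_of_mem_circ (hup S) (hu S).total_pos hS (hx S)
    · obtain ⟨w, hw, i, hi⟩ := exists_form_pos h
      have hmem := mem_packing_iff.2 ⟨w, hw, i, rfl⟩
      have hpole : IsPole (w i) (circ (w i)) := ⟨⟨w, hw, i, rfl⟩, rfl⟩
      refine Or.inr (Set.mem_iUnion.2 ⟨⟨_, hmem⟩, ?_⟩)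
      have hxS := hx ⟨_, hmem⟩
      -- The pole `w i` given by density may differ from the chosen `u`; both describe the same cap.
      rw [← hcap, hO.eq_cap hpole] at hxS ⊢
      exact mem_boundedCone_of_spacelike ((hpole.isTangentApex_iff _).1 (hp ⟨_, hmem⟩))
        hpole.total_pos hxS hy hyt h (by rwa [form_comm])
  · rintro x ((hx | hx) | hx) <;> rw [Set.mem_iInter] <;> intro S
    · obtain ⟨y, hy, hyt, h⟩ := exists_rep_of_timelike hx
      refine mem_unboundedCone_of_discrim (hup S) (hu S).total_pos (hu S).form_self_pos hy hyt ?_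
        (Or.inl h.le)
      nlinarith [mul_pos (hu S).form_self_pos (neg_pos.2 h), sq_nonneg (form (u S) y)]
    · obtain ⟨y, hy, hyt, h⟩ := exists_rep_of_lightlike hx.1
      refine mem_unboundedCone_of_discrim (hup S) (hu S).total_pos (hu S).form_self_pos hy hyt ?_
        (Or.inl h.le)
      have h0 : form (u S) y ≠ 0 := by
        intro h0
        refine (hx.2 S).1 ?_
        rw [(hu S).circ_eq]
        exact mem_circ_of_mem hy (ne_zero_of_total hyt) h h0
      rw [h, mul_zero]
      positivity
    · obtain ⟨T, hT⟩ := Set.mem_iUnion.1 hx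
      by_cases hST : S = T
      · subst hST
        exact boundedCone_subset_unboundedCone _ _ hT
      · exact boundedCone_subset_of_separated (hup S) (hup T) (hu S).form_self (hu T).form_self
          (hu S).total_pos (hu T).total_pos
          ((hu S).form_le (hu T) (Subtype.coe_ne_coe.2 hST)) hT

end ApollonianCone

theorem proposition5p1 :
    (∀ S ∈ ApollonianCone.packing, ∃! p, ApollonianCone.IsTangentApex p S) ∧
    (∃ O : ApollonianCone.packing → Set ApollonianCone.P3, ApollonianCone.IsCapSystem O) ∧
    ∀ (O : ApollonianCone.packing → Set ApollonianCone.P3)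
      (p : ApollonianCone.packing → ApollonianCone.P3),
      ApollonianCone.IsCapSystem O →
      (∀ S : ApollonianCone.packing, ApollonianCone.IsTangentApex (p S) S) →
      (⋂ S : ApollonianCone.packing, ApollonianCone.unboundedCone (p S) (O S)) =
        ApollonianCone.timelike ∪ ApollonianCone.residualSet O ∪
          ⋃ S : ApollonianCone.packing, ApollonianCone.boundedCone (p S) (O S) := by
  refine ⟨fun S hS => ?_, ApollonianCone.exists_isCapSystem,
    fun O p hO hp => ApollonianCone.iInter_unboundedCone_eq hO hp⟩
  obtain ⟨u, hu⟩ := ApollonianCone.exists_isPole hS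
  refine ⟨Projectivization.mk ℝ u hu.ne_zero,
    (hu.isTangentApex_iff _).2 (ApollonianCone.mem_mk u hu.ne_zero), fun q hq => ?_⟩
  exact ApollonianCone.eq_of_mem_submodule ((hu.isTangentApex_iff q).1 hq)
    (ApollonianCone.mem_mk u hu.ne_zero) hu.ne_zero
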